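/- Let $K$ be an algebraically closed field of characteristic zero, $n,d\ge 1$, $R=K[x_0,\dots,x_n]$, and let $Q=K[X_0,\dots,X_n]$ act on $R$ by $X_i=\partial/\partial x_i$. For an ideal $I\subset Q$ put $I^{-1}=\{f\in R: \alpha(f)=0 \text{ for all }\alpha\in I\}$ and let $(I^{-1})_d$ be its space of forms of degree $d$. Let $\varphi_d=(F_1:\dots:F_h)\colon\mathbb P^n\dashrightarrow\mathbb P^{h-1}$ be the rational map given by a basis of $(I^{-1})_d$, and let $X_d$ be the Zariski closure of its image. The $s$-th osculating space of $X_d$ at $\varphi_d(P)$ is the projectivization of the span of all partial derivatives of $(F_1,\dots,F_h)$ of order $\le s$ at $P$; $X_d$ satisfies a Laplace equation of order $s$ if at a general point of $X_d$ this space has dimension less than $\binom{n+s}{s}-1$. Let $\Delta_n=\operatorname{conv}(e_0,\dots,e_n)\subset\mathbb R^{n+1}$ and let $A_I\subset d\Delta_n\cap\mathbb Z^{n+1}$ be the set of exponents of the monomials lying in $(I^{-1})_d$. A hypersurface of degree $s$ is the zero locus of a nonzero form of degree $s$ in $n+1$ variables over $K$. A Togliatti system (of degree $d$) is an Artinian ideal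 of $Q$ (i.e. one with Artinian quotient) generated by at most $\binom{n+d-1}{n-1}$ forms of degree $d$ for which $X_d$ satisfies a Laplace equation of order $d-1$; it is monomial if it can be generated by monomials; a monomial Togliatti system is minimal if no proper subset of its set of monomial generators of degree $d$ generates a monomial Togliatti system. Let $I\subset Q$ be an Artinian ideal generated by $r\le\binom{n+d-1}{n-1}$ monomials of degree $d$. (a) For every $s\in\{1,\dots,d-1\}$, $X_d$ satisfies a Laplace equation of order $s$ if and only if there is a hypersurface of degree $s$ containing $A_I$. In particular, $s$ is the least integer in $\{1,\dots,d-1\}$ such that $X_d$ satisfies a Laplace equation of order $s$ if and only if $s$ is the least integer in $\{1,\dots,d-1\}$ such that there is a hypersurface of degree $s$ containing $A_I$. (b) The following are equivalent: (i) $I$ is a minimal (monomial) Togliatti system; (ii) some hypersurface of degree $s$ with $s\in\{1,\dots,d-1\}$ contains $A_I$, and no hypersurface of degree in $\{1,\dots,d-1\}$ that contains $A_I$ contains a lattice point of $d\Delta_n\setminus A_I$, except possibly some of the vertices of $d\Delta_n$; (iii) some hypersurface of degree $d-1$ contains $A_I$, and no hypersurface of degree $d-1$ that contains $A_I$ contains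 a lattice point of $d\Delta_n\setminus A_I$, except possibly some of the vertices of $d\Delta_n$. -/

import Mathlib

open MvPolynomial

namespace Togliatti

/-- The polynomial ring in the `n + 1` variables indexed by `0, …, n`. It serves both as
`R = K[x₀, …, xₙ]` and as the ring `Q = K[X₀, …, Xₙ]` of differential operators. -/
abbrev Ring (n : ℕ) (K : Type*) [Field K] := MvPolynomial (Fin (n + 1)) K

/-- Exponents of monomials in `n + 1` variables, i.e. points of `ℤ^(n+1)` with nonnegative
coordinates. -/
abbrev Exponent (n : ℕ) := Fin (n + 1) →₀ ℕ

section Apolarity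

variable {n : ℕ} {K : Type*} [Field K]

/-- The differential operator `(∂/∂x₀)^m₀ ∘ ⋯ ∘ (∂/∂xₙ)^mₙ` on `R`. -/
noncomputable def partialDeriv (m : Exponent n) : Ring n K →ₗ[K] Ring n K :=
  (List.ofFn fun i : Fin (n + 1) =>
    ((pderiv i : Derivation K (Ring n K) (Ring n K)).toLinearMap ^ m i :
      Module.End K (Ring n K))).prod

/-- The apolarity action `f ↦ α(f)` of `α ∈ Q` on `R`, given by `X_i = ∂/∂x_i`. -/
noncomputable def apolar (α : Ring n K) : Ring n K →ₗ[K] Ring n K :=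
  ∑ m ∈ α.support, α.coeff m • partialDeriv m

/-- Macaulay's inverse system `I⁻¹ = {f ∈ R | α(f) = 0 for all α ∈ I}`, as a `K`-subspace of `R`. -/
noncomputable def inverseSystem (I : Ideal (Ring n K)) : Submodule K (Ring n K) :=
  ⨅ α ∈ I, LinearMap.ker (apolar α)

/-- The graded piece `(I⁻¹)_d`. -/
noncomputable def inverseSystemDegree (I : Ideal (Ring n K)) (d : ℕ) : Submodule K (Ring n K) :=
  inverseSystem I ⊓ homogeneousSubmodule (Fin (n + 1)) K d

/-- The lattice points of the dilated standard simplex `d Δₙ ⊂ ℝ^(n+1)`. -/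
def simplexPoints (n d : ℕ) : Set (Exponent n) := {a | a.degree = d}

/-- The vertices `d e₀, …, d eₙ` of `d Δₙ`. -/
def simplexVertices (n d : ℕ) : Set (Exponent n) := {a | ∃ i, a = Finsupp.single i d}

/-- The set `A_I` of exponents of the monomials in `(I⁻¹)_d`. -/
def latticeSet (I : Ideal (Ring n K)) (d : ℕ) : Set (Exponent n) :=
  {a | (monomial a (1 : K)) ∈ inverseSystemDegree I d}

end Apolarity

section Osculation

variable {n : ℕ} {K : Type*} [Field K] (W : Submodule K (Ring n K))

/-- The map `K^(n+1) → W*`, `P ↦ (F ↦ F(P))`, attached to a linear system `W` of forms. In the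
coordinates of `W*` given by a basis `F₁, …, F_h` of `W` it is `P ↦ (F₁(P), …, F_h(P))`, so it
induces the rational map `φ_W : ℙⁿ ⇢ ℙ(W*) = ℙ^(h-1)`. -/
noncomputable def coneMap (P : Fin (n + 1) → K) : Module.Dual K W :=
  (aeval P : Ring n K →ₐ[K] K).toLinearMap ∘ₗ W.subtype

/-- The value at a vector `v` of `W*` of a polynomial function on `W*`, written as a polynomial in
the linear coordinates `v ↦ v F` for `F ∈ W`. -/
noncomputable def evalDual (v : Module.Dual K W) (p : MvPolynomial W K) : K :=
  eval (fun F : W => v F) p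

/-- The variety `X ⊂ ℙ(W*)`: the Zariski closure of the image of `φ_W`, i.e. the common zeros of
all homogeneous polynomials that vanish on that image. -/
def imageVariety : Set (Projectivization K (Module.Dual K W)) :=
  {x | ∀ (p : MvPolynomial W K) (e : ℕ), p.IsHomogeneous e →
    (∀ P : Fin (n + 1) → K, coneMap W P ≠ 0 → evalDual W (coneMap W P) p = 0) →
      evalDual W x.rep p = 0}

/-- The affine cone in `W*` over the `s`-th osculating space of `X` at `φ_W(P)`: the span of all
partial derivatives of order at most `s` of the parametrization `φ_W = (F₁ : ⋯ : F_h)` at `P`.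
The projective dimension of the osculating space is the dimension of this vector space minus one. -/
noncomputable def osculatingSpace (s : ℕ) (P : Fin (n + 1) → K) :
    Submodule K (Module.Dual K W) :=
  Submodule.span K {v | ∃ m : Exponent n, m.degree ≤ s ∧
    v = (aeval P : Ring n K →ₐ[K] K).toLinearMap ∘ₗ partialDeriv m ∘ₗ W.subtype}

/-- `X` satisfies (at least) one Laplace equation of order `s`: at a general point `x = φ_W(P)`
of `X` the `s`-th osculating space has (projective) dimension smaller than `C(n+s, s) - 1`.
A general point is one where some fixed homogeneous polynomial `g` that does not vanish
identically on `X` is nonzero, i.e. a point of some nonempty Zariski open subset of `X`. -/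
def SatisfiesLaplace (s : ℕ) : Prop :=
  ∃ (g : MvPolynomial W K) (e : ℕ), g.IsHomogeneous e ∧
    (∃ x ∈ imageVariety W, evalDual W x.rep g ≠ 0) ∧
    ∀ x ∈ imageVariety W, evalDual W x.rep g ≠ 0 →
      ∀ (P : Fin (n + 1) → K) (hP : coneMap W P ≠ 0),
        Projectivization.mk K (coneMap W P) hP = x →
          Module.finrank K (osculatingSpace W s P) < (n + s).choose s

end Osculation

section TogliattiSystems

variable {n : ℕ} {K : Type*} [Field K]

/-- The ideal of `Q` generated by the monomials with exponents in `G`. -/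
noncomputable def monomialIdeal (K : Type*) [Field K] (G : Set (Exponent n)) : Ideal (Ring n K) :=
  Ideal.span ((fun m => monomial m (1 : K)) '' G)

/-- `I` is an Artinian ideal generated by `r ≤ C(n+d-1, n-1)` forms of degree `d` and the variety
`X_d` satisfies at least one Laplace equation of order `d - 1`. -/
structure IsTogliattiSystem (d : ℕ) (I : Ideal (Ring n K)) : Prop where
  artinian : IsArtinianRing (Ring n K ⧸ I)
  generators : ∃ G : Finset (Ring n K), (∀ F ∈ G, F.IsHomogeneous d) ∧
    G.card ≤ (n + d - 1).choose (n - 1) ∧ Ideal.span (G : Set (Ring n K)) = I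
  laplace : SatisfiesLaplace (inverseSystemDegree I d) (d - 1)

/-- A Togliatti system that can be generated by monomials. -/
structure IsMonomialTogliattiSystem (d : ℕ) (I : Ideal (Ring n K)) : Prop
    extends IsTogliattiSystem d I where
  monomial : ∃ G : Set (Exponent n), monomialIdeal K G = I

/-- A monomial Togliatti system such that no proper subset of its set of (degree `d`) monomial
generators defines a monomial Togliatti system. -/
structure IsMinimalTogliattiSystem (d : ℕ) (I : Ideal (Ring n K)) : Prop
    extends IsMonomialTogliattiSystem d I where
  minimal : ∀ G : Set (Exponent n), G ⊆ simplexPoints n d → monomialIdeal K G = I →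
    ∀ G' : Set (Exponent n), G' ⊂ G → ¬ IsMonomialTogliattiSystem d (monomialIdeal K G')

/-- `F` defines a hypersurface of degree `s` in `ℙⁿ`: it is a nonzero form of degree `s`. -/
def IsHypersurface (s : ℕ) (F : Ring n K) : Prop := F ≠ 0 ∧ F.IsHomogeneous s

/-- The hypersurface `F = 0` contains the lattice point `a`. -/
def ContainsPoint (F : Ring n K) (a : Exponent n) : Prop := eval (fun i => (a i : K)) F = 0

/-- The hypersurface `F = 0` contains `A_I`. -/
def ContainsLatticeSet (F : Ring n K) (I : Ideal (Ring n K)) (d : ℕ) : Prop :=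
  ∀ a ∈ latticeSet I d, ContainsPoint F a

/-- The hypersurface `F = 0` contains no lattice point of `d Δₙ` outside `A_I`, except possibly
some of the vertices of `d Δₙ`. -/
def MeetsComplementOnlyInVertices (F : Ring n K) (I : Ideal (Ring n K)) (d : ℕ) : Prop :=
  ∀ a ∈ simplexPoints n d \ latticeSet I d, ContainsPoint F a → a ∈ simplexVertices n d

end TogliattiSystems

end Togliatti

/-! For an ideal generated by a set `G` of monomials of degree `d`, the system `(I⁻¹)_d` is spanned
by the monomials with exponents in `A_I`, the complement of `G` in `d Δₙ ∩ ℤⁿ⁺¹`. At a point `P` of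
the torus, `P^m ∂^m x^a` equals `P^a` times the product of falling factorials
`∏ᵢ aᵢ (aᵢ - 1) ⋯ (aᵢ - mᵢ + 1)`, so after rescaling coordinates the `s`-th osculating space is
spanned by these functions of `a ∈ A_I`, for `|m| ≤ s`. They span the restrictions to `A_I` of the
polynomials of degree at most `s`, and since `∑ᵢ aᵢ = d` is a nonzero constant on `A_I`, these are
the restrictions of the forms of degree `s`. The osculating space therefore has less than the
expected dimension exactly when some nonzero form of degree `s` vanishes on `A_I`.

Removing generators from `G` enlarges `A_I`, and the quotient stays Artinian exactly when the
vertices `d eᵢ` stay in `G`. Hence a proper subset of `G` still generates a Togliatti system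
exactly when a hypersurface of degree `d - 1` through `A_I` passes through a non-vertex of `G`.
Multiplying by a power of `X₀` raises every smaller degree to `d - 1`.
-/

namespace Togliatti

section MultiDescFactorial

open Nat

variable {σ : Type*} [Fintype σ]

/-- The product of falling factorials `∏ᵢ aᵢ (aᵢ - 1) ⋯ (aᵢ - mᵢ + 1)`, which is the coefficient
produced by applying `∂^m` to the monomial `x^a`. -/
def multiDescFactorial (a m : σ →₀ ℕ) : ℕ := ∏ i, (a i).descFactorial (m i)

theorem multiDescFactorial_zero (a : σ →₀ ℕ) : multiDescFactorial a 0 = 1 := by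
  simp [multiDescFactorial]

theorem multiDescFactorial_eq_zero_of_not_le {a m : σ →₀ ℕ} (h : ¬m ≤ a) :
    multiDescFactorial a m = 0 := by
  obtain ⟨i, hi⟩ := not_forall.1 h
  exact Finset.prod_eq_zero (Finset.mem_univ i) (descFactorial_of_lt (not_le.1 hi))

theorem multiDescFactorial_self_dvd_factorial_degree (m : σ →₀ ℕ) :
    multiDescFactorial m m ∣ m.degree ! := by
  simp only [multiDescFactorial, descFactorial_self, Finsupp.degree_eq_sum]
  exact prod_factorial_dvd_factorial_sum _ _

theorem cast_multiDescFactorial_add_single {R : Type*} [CommRing R] (a m : σ →₀ ℕ) (i : σ) :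
    (multiDescFactorial a (m + Finsupp.single i 1) : R) =
      ((a i : R) - m i) * multiDescFactorial a m := by
  classical
  have descFactorial_succ_cast (k l : ℕ) :
      (k.descFactorial (l + 1) : R) = ((k : R) - l) * k.descFactorial l := by
    rw [← descPochhammer_eval_eq_descFactorial, descPochhammer_succ_eval,
      descPochhammer_eval_eq_descFactorial, mul_comm]
  simp only [multiDescFactorial, cast_prod]
  rw [← Finset.mul_prod_erase _ _ (Finset.mem_univ i),
    ← Finset.mul_prod_erase _ (fun j => ((a j).descFactorial (m j) : R)) (Finset.mem_univ i),
    ← mul_assoc, Finsupp.add_apply, Finsupp.single_eq_same, descFactorial_succ_cast]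
  refine congrArg _ (Finset.prod_congr rfl fun j hj => ?_)
  rw [Finsupp.add_apply, Finsupp.single_eq_of_ne (Finset.ne_of_mem_erase hj), add_zero]

end MultiDescFactorial

section PartialDerivatives

variable {σ R : Type*} [CommSemiring R]

theorem pderiv_pow_monomial (i : σ) (k : ℕ) (a : σ →₀ ℕ) (c : R) :
    ((pderiv i : Derivation R (MvPolynomial σ R) _).toLinearMap ^ k) (monomial a c) =
      monomial (a - Finsupp.single i k) (c * ((a i).descFactorial k : R)) := by
  induction k with
  | zero => simp
  | succ k ih =>
    rw [pow_succ', Module.End.mul_apply, ih, Derivation.coeFn_coe, pderiv_monomial, tsub_tsub,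
      ← Finsupp.single_add, Finsupp.tsub_apply, Finsupp.single_eq_same, Nat.descFactorial_succ,
      Nat.cast_mul, mul_assoc, mul_comm (((a i - k : ℕ) : R))]

theorem prod_pderiv_pow_monomial [DecidableEq σ] (m a : σ →₀ ℕ) (c : R) {l : List σ}
    (hl : l.Nodup) :
    (l.map fun i => (pderiv i : Derivation R (MvPolynomial σ R) _).toLinearMap ^ m i).prod
        (monomial a c) =
      monomial (a - m.filter (· ∈ l)) (c * ∏ i ∈ l.toFinset, ((a i).descFactorial (m i) : R)) := by
  induction l with
  | nil =>
    have hfilter : m.filter (· ∈ ([] : List σ)) = 0 := by ext; simp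
    rw [hfilter]
    simp
  | cons i l ih =>
    obtain ⟨hi, hl⟩ := List.nodup_cons.1 hl
    have hsub : a - m.filter (· ∈ l) - Finsupp.single i (m i) = a - m.filter (· ∈ i :: l) := by
      ext j
      obtain rfl | hj := eq_or_ne j i <;> simp_all [Finsupp.filter_apply]
    rw [List.map_cons, List.prod_cons, Module.End.mul_apply, ih hl, pderiv_pow_monomial, hsub,
      Finsupp.tsub_apply, Finsupp.filter_apply_neg _ _ hi, tsub_zero, List.toFinset_cons,
      Finset.prod_insert (by simpa using hi), mul_assoc, mul_comm (Finset.prod _ _)]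

end PartialDerivatives

section Apolarity

variable {n : ℕ} {K : Type*} [Field K]

theorem partialDeriv_monomial (m a : Exponent n) (c : K) :
    partialDeriv m (monomial a c) = monomial (a - m) (c * multiDescFactorial a m) := by
  rw [partialDeriv, List.ofFn_eq_map, prod_pderiv_pow_monomial m a c (List.nodup_finRange _)]
  simp [multiDescFactorial, (Finsupp.filter_eq_self_iff _ _).2]

theorem prod_pow_mul_eval_partialDeriv_monomial (P : Fin (n + 1) → K) (m a : Exponent n) :
    (∏ i, P i ^ m i) * eval P (partialDeriv m (monomial a 1)) =
      multiDescFactorial a m * ∏ i, P i ^ a i := by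
  rw [partialDeriv_monomial, eval_monomial, Finsupp.prod_fintype _ _ fun _ => pow_zero _, one_mul]
  by_cases hma : m ≤ a
  · rw [mul_left_comm, ← Finset.prod_mul_distrib]
    simp only [Finsupp.tsub_apply, ← pow_add, Nat.add_sub_cancel' (hma _)]
  · simp [multiDescFactorial_eq_zero_of_not_le hma]

theorem eq_of_le_of_degree_eq {σ : Type*} {m a : σ →₀ ℕ} (hle : m ≤ a)
    (hdeg : m.degree = a.degree) : m = a := by
  obtain ⟨b, rfl⟩ := exists_add_of_le hle
  have hb : b.degree = 0 := by simpa using hdeg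
  rw [(Finsupp.degree_eq_zero_iff b).1 hb, add_zero]

theorem partialDeriv_eq_C_of_isHomogeneous {m : Exponent n} {f : Ring n K}
    (hf : f.IsHomogeneous m.degree) :
    partialDeriv m f = C (f.coeff m * multiDescFactorial m m) := by
  conv_lhs => rw [f.as_sum, map_sum]
  simp only [partialDeriv_monomial]
  rw [Finset.sum_eq_single m, tsub_self, C_apply]
  · intro b hb hbm
    have hnle : ¬m ≤ b := fun hle =>
      hbm (eq_of_le_of_degree_eq hle (hf.degree_eq_sum_deg_support hb)).symm
    rw [multiDescFactorial_eq_zero_of_not_le hnle, Nat.cast_zero, mul_zero, monomial_zero]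
  · intro hm
    rw [notMem_support_iff.1 hm, zero_mul, monomial_zero]

theorem apolar_monomial_one (m : Exponent n) (f : Ring n K) :
    apolar (monomial m 1) f = partialDeriv m f := by
  simp [apolar]

theorem mem_inverseSystem {I : Ideal (Ring n K)} {f : Ring n K} :
    f ∈ inverseSystem I ↔ ∀ α ∈ I, apolar α f = 0 := by
  simp [inverseSystem]

end Apolarity

section MonomialIdeals

variable {n d : ℕ} {K : Type*} [Field K] {G : Set (Exponent n)}

theorem mem_monomialIdeal {f : Ring n K} :
    f ∈ monomialIdeal K G ↔ ∀ a ∈ f.support, ∃ m ∈ G, m ≤ a :=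
  mem_ideal_span_monomial_image

theorem monomial_mem_monomialIdeal_iff (hG : G ⊆ simplexPoints n d) {a : Exponent n}
    (ha : a ∈ simplexPoints n d) : monomial a (1 : K) ∈ monomialIdeal K G ↔ a ∈ G := by
  refine ⟨fun h => ?_, fun h => Ideal.subset_span ⟨a, h, rfl⟩⟩
  obtain ⟨m, hm, hma⟩ := mem_monomialIdeal.1 h a (by simp)
  rwa [← eq_of_le_of_degree_eq hma ((hG hm).trans ha.symm)]

variable (K) in
theorem monomialIdeal_injOn (n d : ℕ) :
    Set.InjOn (monomialIdeal K) (𝒫 simplexPoints n d) := by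
  intro G hG G' hG' h
  ext a
  by_cases ha : a ∈ simplexPoints n d
  · rw [← monomial_mem_monomialIdeal_iff (K := K) hG ha, h, monomial_mem_monomialIdeal_iff hG' ha]
  · exact iff_of_false (fun h => ha (hG h)) (fun h => ha (hG' h))

theorem inverseSystemDegree_monomialIdeal_le (hd : (d.factorial : K) ≠ 0)
    (hG : G ⊆ simplexPoints n d) :
    inverseSystemDegree (monomialIdeal K G) d ≤ restrictSupport K (simplexPoints n d \ G) := by
  rintro f ⟨hfI, hfd⟩
  rw [SetLike.mem_coe, mem_homogeneousSubmodule] at hfd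
  refine (mem_restrictSupport_iff K).2 fun a ha => ?_
  obtain rfl : d = a.degree := hfd.degree_eq_sum_deg_support ha
  refine ⟨rfl, fun haG => ?_⟩
  have hzero : f.coeff a * multiDescFactorial a a = 0 := by
    rw [← C_eq_zero (σ := Fin (n + 1)), ← partialDeriv_eq_C_of_isHomogeneous hfd,
      ← apolar_monomial_one]
    exact mem_inverseSystem.1 hfI _ ((monomial_mem_monomialIdeal_iff hG rfl).2 haG)
  have hdvd := Nat.cast_dvd_cast (α := K) (multiDescFactorial_self_dvd_factorial_degree a)
  exact mul_ne_zero (mem_support_iff.1 ha) (ne_zero_of_dvd_ne_zero hd hdvd) hzero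

variable (K) in
theorem restrictSupport_le_inverseSystemDegree (hG : G ⊆ simplexPoints n d) :
    restrictSupport K (simplexPoints n d \ G) ≤ inverseSystemDegree (monomialIdeal K G) d := by
  rw [restrictSupport_eq_span, Submodule.span_le]
  rintro _ ⟨a, ⟨had, haG⟩, rfl⟩
  refine ⟨mem_inverseSystem.2 fun α hα => ?_, isHomogeneous_monomial _ had⟩
  rw [apolar, LinearMap.sum_apply]
  refine Finset.sum_eq_zero fun m hm => ?_
  obtain ⟨b, hbG, hbm⟩ := mem_monomialIdeal.1 hα m hm
  have hnle : ¬m ≤ a := fun hma =>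
    haG (eq_of_le_of_degree_eq (hbm.trans hma) ((hG hbG).trans had.symm) ▸ hbG)
  simp [partialDeriv_monomial, multiDescFactorial_eq_zero_of_not_le hnle]

theorem inverseSystemDegree_monomialIdeal (hd : (d.factorial : K) ≠ 0)
    (hG : G ⊆ simplexPoints n d) :
    inverseSystemDegree (monomialIdeal K G) d = restrictSupport K (simplexPoints n d \ G) :=
  (inverseSystemDegree_monomialIdeal_le hd hG).antisymm
    (restrictSupport_le_inverseSystemDegree K hG)

theorem latticeSet_monomialIdeal (hd : (d.factorial : K) ≠ 0) (hG : G ⊆ simplexPoints n d) :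
    latticeSet (monomialIdeal K G) d = simplexPoints n d \ G := by
  ext a
  simp [latticeSet, inverseSystemDegree_monomialIdeal hd hG]

end MonomialIdeals

section LatticeValues

variable {σ R : Type*} [CommSemiring R]

variable (R) in
/-- The restriction of polynomial functions to a set `A` of lattice points. -/
noncomputable def evalLattice (A : Set (σ →₀ ℕ)) : MvPolynomial σ R →ₐ[R] (A → R) :=
  AlgHom.pi fun a => aeval fun i => (a.1 i : R)

theorem evalLattice_apply (A : Set (σ →₀ ℕ)) (F : MvPolynomial σ R) (a : A) :
    evalLattice R A F a = eval (fun i => (a.1 i : R)) F := by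
  simp [evalLattice, aeval_eq_eval]

variable (R) in
/-- The space of functions on a set `A` of lattice points that are given by forms of degree `s`. -/
noncomputable def formValues (A : Set (σ →₀ ℕ)) (s : ℕ) : Submodule R (A → R) :=
  (homogeneousSubmodule σ R s).map (evalLattice R A).toLinearMap

variable (R) in
/-- The space of functions `a ↦ ∏ᵢ aᵢ (aᵢ - 1) ⋯ (aᵢ - mᵢ + 1)` with `|m| ≤ s` on a set `A` of
lattice points. At a point of the torus it is a coordinate version of the `s`-th osculating space
of the variety parametrized by the monomials with exponents in `A`. -/
noncomputable def descFactorialSpan [Fintype σ] (A : Set (σ →₀ ℕ)) (s : ℕ) : Submodule R (A → R) :=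
  Submodule.span R ((fun m a => (multiDescFactorial a.1 m : R)) '' {m | m.degree ≤ s})

theorem formValues_eq_pow (A : Set (σ →₀ ℕ)) (s : ℕ) :
    formValues R A s = formValues R A 1 ^ s := by
  rw [formValues, ← homogeneousSubmodule_one_pow, Submodule.map_pow, formValues]

theorem formValues_one_eq_span (A : Set (σ →₀ ℕ)) :
    formValues R A 1 = Submodule.span R (Set.range fun i a => (a.1 i : R)) := by
  rw [formValues, homogeneousSubmodule_one_eq_span_X, Submodule.map_span, ← Set.range_comp]
  congr 2
  ext i a
  simp [evalLattice_apply]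

variable {K : Type*} [Field K] {A : Set (σ →₀ ℕ)} {d : ℕ}

theorem one_mem_formValues_one [Finite σ] (hd : (d : K) ≠ 0) (hA : ∀ a ∈ A, a.degree = d) :
    1 ∈ formValues K A 1 := by
  cases nonempty_fintype σ
  have hsum : (1 : A → K) = (d : K)⁻¹ • ∑ i, fun a : A => (a.1 i : K) := by
    ext a
    rw [Pi.smul_apply, Finset.sum_apply, ← Nat.cast_sum, ← Finsupp.degree_eq_sum, hA a a.2,
      smul_eq_mul, inv_mul_cancel₀ hd, Pi.one_apply]
  rw [hsum, formValues_one_eq_span]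
  exact Submodule.smul_mem _ _ (Submodule.sum_mem _ fun i _ => Submodule.subset_span ⟨i, rfl⟩)

variable [Fintype σ]

theorem multiDescFactorial_mem_formValues (hd : (d : K) ≠ 0) (hA : ∀ a ∈ A, a.degree = d)
    (m : σ →₀ ℕ) : (fun a : A => (multiDescFactorial a.1 m : K)) ∈ formValues K A m.degree := by
  rw [formValues_eq_pow]
  induction h : m.degree generalizing m with
  | zero =>
    rw [(Finsupp.degree_eq_zero_iff m).1 h, pow_zero]
    simp only [multiDescFactorial_zero, Nat.cast_one]
    exact Submodule.one_le.1 (le_refl (1 : Submodule K (A → K)))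
  | succ s ih =>
    obtain ⟨i, hi⟩ : ∃ i, m i ≠ 0 := by
      by_contra! hm
      simp [Finsupp.degree_eq_sum, hm] at h
    obtain ⟨k, rfl⟩ : ∃ k, m = k + Finsupp.single i 1 :=
      ⟨_, (Finsupp.sub_add_single_one_cancel hi).symm⟩
    have hlin : (fun a : A => (a.1 i : K)) - (k i : K) • 1 ∈ formValues K A 1 := by
      refine Submodule.sub_mem _ ?_ (Submodule.smul_mem _ _ (one_mem_formValues_one hd hA))
      rw [formValues_one_eq_span]
      exact Submodule.subset_span ⟨i, rfl⟩
    rw [pow_succ']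
    convert! Submodule.mul_mem_mul hlin (ih k (by simpa using h)) using 1
    ext a
    simp [cast_multiDescFactorial_add_single]

theorem descFactorialSpan_le_formValues (hd : (d : K) ≠ 0) (hA : ∀ a ∈ A, a.degree = d) (s : ℕ) :
    descFactorialSpan K A s ≤ formValues K A s := by
  rw [descFactorialSpan, Submodule.span_le]
  rintro _ ⟨m, hm, rfl⟩
  have hmono : formValues K A m.degree ≤ formValues K A s := by
    rw [formValues_eq_pow, formValues_eq_pow A s]
    exact pow_le_pow_right' (Submodule.one_le.2 (one_mem_formValues_one hd hA)) hm
  exact hmono (multiDescFactorial_mem_formValues hd hA m)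

theorem formValues_one_mul_descFactorialSpan_le {S : Type*} [CommRing S] (A : Set (σ →₀ ℕ))
    (s : ℕ) : formValues S A 1 * descFactorialSpan S A s ≤ descFactorialSpan S A (s + 1) := by
  rw [formValues_one_eq_span, descFactorialSpan, Submodule.span_mul_span, Submodule.span_le]
  rintro _ ⟨_, ⟨i, rfl⟩, _, ⟨m, hm, rfl⟩, rfl⟩
  have hmul : (fun a : A => (a.1 i : S)) * (fun a : A => (multiDescFactorial a.1 m : S)) =
      (fun a : A => (multiDescFactorial a.1 (m + Finsupp.single i 1) : S)) +
        (m i : S) • fun a : A => (multiDescFactorial a.1 m : S) := by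
    ext a
    simp [cast_multiDescFactorial_add_single, sub_mul]
  have hm' : m.degree ≤ s := hm
  simp only [hmul]
  exact Submodule.add_mem _ (Submodule.subset_span ⟨_, by simpa using hm', rfl⟩)
    (Submodule.smul_mem _ _ (Submodule.subset_span ⟨m, hm'.trans s.le_succ, rfl⟩))

theorem formValues_le_descFactorialSpan {S : Type*} [CommRing S] (A : Set (σ →₀ ℕ)) (s : ℕ) :
    formValues S A s ≤ descFactorialSpan S A s := by
  rw [formValues_eq_pow]
  induction s with
  | zero =>
    rw [pow_zero, Submodule.one_le]
    refine Submodule.subset_span ⟨0, by simp, ?_⟩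
    simp only [multiDescFactorial_zero, Nat.cast_one]
    rfl
  | succ s ih =>
    rw [pow_succ']
    exact (mul_le_mul_right ih _).trans (formValues_one_mul_descFactorialSpan_le A s)

theorem descFactorialSpan_eq_formValues (hd : (d : K) ≠ 0) (hA : ∀ a ∈ A, a.degree = d) (s : ℕ) :
    descFactorialSpan K A s = formValues K A s :=
  (descFactorialSpan_le_formValues hd hA s).antisymm (formValues_le_descFactorialSpan A s)

end LatticeValues

section Rank

theorem finrank_map_lt_finrank_iff {K V V' : Type*} [Field K] [AddCommGroup V] [Module K V]
    [AddCommGroup V'] [Module K V'] (f : V →ₗ[K] V') (W : Submodule K V) [FiniteDimensional K W] :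
    Module.finrank K (W.map f) < Module.finrank K W ↔ ∃ x ∈ W, x ≠ 0 ∧ f x = 0 := by
  rw [← LinearMap.range_domRestrict, ← (f.domRestrict W).finrank_range_add_finrank_ker,
    lt_add_iff_pos_right, Module.finrank_pos_iff_exists_ne_zero]
  simp [and_comm, and_left_comm]

variable {n : ℕ} {K : Type*} [Field K]

theorem ncard_simplexPoints (n d : ℕ) : (simplexPoints n d).ncard = (n + d).choose d := by
  have hcoe : simplexPoints n d = (Finset.univ.finsuppAntidiag d : Finset (Exponent n)) := by
    ext a
    simp [simplexPoints, Finsupp.degree_eq_sum, Finset.mem_finsuppAntidiag]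
  rw [hcoe, Set.ncard_coe_finset, Finset.card_finsuppAntidiag_nat_eq_choose, Finset.card_fin,
    add_right_comm, Nat.add_sub_cancel]

theorem finrank_homogeneousSubmodule (n s : ℕ) (K : Type*) [Field K] :
    Module.finrank K (homogeneousSubmodule (Fin (n + 1)) K s) = (n + s).choose s := by
  rw [homogeneousSubmodule_eq_finsupp_supported, ← ncard_simplexPoints, ← Nat.card_coe_set_eq]
  exact Module.finrank_eq_nat_card_basis (basisRestrictSupport K (simplexPoints n s))

theorem finrank_formValues_lt_iff (A : Set (Exponent n)) (s : ℕ) :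
    Module.finrank K (formValues K A s) < (n + s).choose s ↔
      ∃ F : Ring n K, IsHypersurface s F ∧ ∀ a ∈ A, ContainsPoint F a := by
  have : FiniteDimensional K (homogeneousSubmodule (Fin (n + 1)) K s) :=
    Module.Finite.iff_fg.2 (homogeneousSubmodule_fg _ _ s)
  rw [formValues, ← finrank_homogeneousSubmodule n s K, finrank_map_lt_finrank_iff]
  simp [IsHypersurface, ContainsPoint, funext_iff, evalLattice_apply, and_assoc, and_left_comm]

end Rank

section Osculation

theorem span_image_smul {ι R M : Type*} [CommSemiring R] [AddCommMonoid M] [Module R M]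
    (S : Set ι) (v : ι → M) {w : ι → R} (hw : ∀ i, IsUnit (w i)) :
    Submodule.span R ((fun i => w i • v i) '' S) = Submodule.span R (v '' S) := by
  refine le_antisymm (Submodule.span_le.2 ?_) (Submodule.span_le.2 ?_)
  · rintro _ ⟨i, hi, rfl⟩
    exact Submodule.smul_mem _ _ (Submodule.subset_span ⟨i, hi, rfl⟩)
  · rintro _ ⟨i, hi, rfl⟩
    exact (Submodule.smul_mem_iff_of_isUnit _ (hw i)).1 (Submodule.subset_span ⟨i, hi, rfl⟩)

theorem coe_basisRestrictSupport {σ R : Type*} [CommSemiring R] (A : Set (σ →₀ ℕ)) (a : A) :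
    (basisRestrictSupport R A a : MvPolynomial σ R) = monomial a.1 1 := by
  classical
  have hbasis : basisRestrictSupport R A a =
      ⟨monomial a.1 1, (monomial_mem_restrictSupport R).2 (Or.inl a.2)⟩ := by
    rw [Module.Basis.apply_eq_iff]
    ext b
    change coeff b.1 (monomial a.1 (1 : R)) = _
    rw [coeff_monomial, Finsupp.single_apply]
    simp only [Subtype.ext_iff]
  rw [hbasis]

variable {n : ℕ} {K : Type*} [Field K]

/-- The functional `F ↦ (∂^m F)(P)` on a linear system `W`, i.e. the partial derivative of index
`m` of the parametrization `coneMap W` at the point `P`. -/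
noncomputable def evalPartialDeriv (W : Submodule K (Ring n K)) (P : Fin (n + 1) → K)
    (m : Exponent n) : Module.Dual K W :=
  (aeval P : Ring n K →ₐ[K] K).toLinearMap ∘ₗ partialDeriv m ∘ₗ W.subtype

theorem evalPartialDeriv_apply (W : Submodule K (Ring n K)) (P : Fin (n + 1) → K)
    (m : Exponent n) (F : W) : evalPartialDeriv W P m F = eval P (partialDeriv m F.1) := by
  simp [evalPartialDeriv, aeval_eq_eval]

theorem osculatingSpace_eq_span_image (W : Submodule K (Ring n K)) (s : ℕ)
    (P : Fin (n + 1) → K) :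
    osculatingSpace W s P = Submodule.span K (evalPartialDeriv W P '' {m | m.degree ≤ s}) := by
  simp only [osculatingSpace, evalPartialDeriv, Set.image, Set.mem_ofPred_eq, eq_comm]

theorem prod_pow_ne_zero {σ R : Type*} [Fintype σ] [CommSemiring R] [NoZeroDivisors R]
    [Nontrivial R] {P : σ → R} (hP : ∀ i, P i ≠ 0) (m : σ →₀ ℕ) : ∏ i, P i ^ m i ≠ 0 :=
  Finset.prod_ne_zero_iff.2 fun i _ => pow_ne_zero _ (hP i)

/-- The monomials `x^a`, `a ∈ A`, rescaled so that each of them takes the value `1` at the torus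
point `P`, as a basis of their span. -/
noncomputable def normalizedMonomialBasis (A : Set (Exponent n)) {P : Fin (n + 1) → K}
    (hP : ∀ i, P i ≠ 0) : Module.Basis A K (restrictSupport K A) :=
  (basisRestrictSupport K A).isUnitSMul (w := fun a => (∏ i, P i ^ a.1 i)⁻¹)
    fun a => (inv_ne_zero (prod_pow_ne_zero hP a)).isUnit

theorem evalPartialDeriv_eq_smul_constr (A : Set (Exponent n)) {P : Fin (n + 1) → K}
    (hP : ∀ i, P i ≠ 0) (m : Exponent n) :
    evalPartialDeriv (restrictSupport K A) P m = (∏ i, P i ^ m i)⁻¹ •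
      (normalizedMonomialBasis A hP).constr K fun a => (multiDescFactorial a.1 m : K) := by
  refine (normalizedMonomialBasis A hP).ext fun a => ?_
  have hm := prod_pow_ne_zero hP m
  have ha := prod_pow_ne_zero hP a.1
  rw [LinearMap.smul_apply, Module.Basis.constr_basis, normalizedMonomialBasis,
    Module.Basis.isUnitSMul_apply, map_smul, evalPartialDeriv_apply, coe_basisRestrictSupport,
    smul_eq_mul, smul_eq_mul, inv_mul_eq_iff_eq_mul₀ ha, mul_left_comm, eq_inv_mul_iff_mul_eq₀ hm,
    prod_pow_mul_eval_partialDeriv_monomial, mul_comm]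

theorem finrank_osculatingSpace_of_torus (A : Set (Exponent n)) {P : Fin (n + 1) → K}
    (hP : ∀ i, P i ≠ 0) (s : ℕ) :
    Module.finrank K (osculatingSpace (restrictSupport K A) s P) =
      Module.finrank K (descFactorialSpan K A s) := by
  have hmap : osculatingSpace (restrictSupport K A) s P = (descFactorialSpan K A s).map
      ((normalizedMonomialBasis A hP).constr K).toLinearMap := by
    rw [osculatingSpace_eq_span_image, funext (evalPartialDeriv_eq_smul_constr A hP),
      span_image_smul _ _ fun m => (inv_ne_zero (prod_pow_ne_zero hP m)).isUnit,
      descFactorialSpan, Submodule.map_span, Set.image_image]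
    rfl
  rw [hmap]
  exact LinearEquiv.finrank_map_eq _ _

theorem osculatingSpace_congr {A : Set (Exponent n)} {P P' : Fin (n + 1) → K}
    (h : ∀ a ∈ A, ∀ i, a i ≠ 0 → P i = P' i) (s : ℕ) :
    osculatingSpace (restrictSupport K A) s P = osculatingSpace (restrictSupport K A) s P' := by
  have hderiv (m : Exponent n) :
      evalPartialDeriv (restrictSupport K A) P m = evalPartialDeriv (restrictSupport K A) P' m := by
    refine (basisRestrictSupport K A).ext fun a => ?_
    rw [evalPartialDeriv_apply, evalPartialDeriv_apply, coe_basisRestrictSupport,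
      partialDeriv_monomial, eval_monomial, eval_monomial]
    refine congrArg _ (Finsupp.prod_congr fun i hi => ?_)
    rw [h a a.2 i fun hai => by simp [hai] at hi]
  rw [osculatingSpace_eq_span_image, osculatingSpace_eq_span_image, funext hderiv]

theorem finrank_osculatingSpace {A : Set (Exponent n)} {P : Fin (n + 1) → K}
    (hP : ∀ a ∈ A, ∏ i, P i ^ a i ≠ 0) (s : ℕ) :
    Module.finrank K (osculatingSpace (restrictSupport K A) s P) =
      Module.finrank K (descFactorialSpan K A s) := by
  classical
  -- A coordinate of `P` that vanishes occurs in no monomial of `A`, so it may be replaced by `1`.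
  let P' : Fin (n + 1) → K := fun i => if P i = 0 then 1 else P i
  have hP' (i : Fin (n + 1)) : P' i ≠ 0 := by
    by_cases hi : P i = 0 <;> simp [P', hi]
  have hcongr : ∀ a ∈ A, ∀ i, a i ≠ 0 → P i = P' i := fun a ha i hai => by
    have hi := Finset.prod_ne_zero_iff.1 (hP a ha) i (Finset.mem_univ i)
    exact (if_neg ((pow_ne_zero_iff hai).1 hi)).symm
  rw [osculatingSpace_congr hcongr, finrank_osculatingSpace_of_torus A hP']

end Osculation

section GeneralPoint

theorem eval_smul_of_isHomogeneous {σ R : Type*} [CommSemiring R] {p : MvPolynomial σ R} {e : ℕ}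
    (hp : p.IsHomogeneous e) (c : R) (x : σ → R) : eval (c • x) p = c ^ e * eval x p := by
  rw [eval_eq, eval_eq, Finset.mul_sum]
  refine Finset.sum_congr rfl fun m hm => ?_
  rw [hp.degree_eq_sum_deg_support hm, ← Finset.prod_pow_eq_pow_sum, mul_left_comm,
    ← Finset.prod_mul_distrib]
  simp only [Pi.smul_apply, smul_eq_mul, mul_pow]

theorem exists_torus_eval_ne_zero {σ R : Type*} [CommRing R] [IsDomain R] [Infinite R]
    {p : MvPolynomial σ R} (hp : p ≠ 0) : ∃ P : σ → R, (∀ i, P i ≠ 0) ∧ eval P p ≠ 0 := by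
  by_contra! h
  have hinf : ({0}ᶜ : Set R).Infinite := (Set.finite_singleton 0).infinite_compl
  exact hp (funext_set (fun _ => {0}ᶜ) (fun _ => hinf) fun P hP => by
    rw [h P fun i => hP i (Set.mem_univ i), map_zero])

variable {n : ℕ} {K : Type*} [Field K] {W : Submodule K (Ring n K)}

theorem evalDual_rep_mk_eq_zero_iff {p : MvPolynomial W K} {e : ℕ} (hp : p.IsHomogeneous e)
    {v : Module.Dual K W} (hv : v ≠ 0) :
    evalDual W (Projectivization.mk K v hv).rep p = 0 ↔ evalDual W v p = 0 := by
  obtain ⟨c, hc⟩ := Projectivization.exists_smul_eq_mk_rep K v hv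
  have hsmul : evalDual W (c • v) p = (c : K) ^ e * evalDual W v p :=
    eval_smul_of_isHomogeneous hp _ _
  rw [← hc, hsmul, mul_eq_zero, or_iff_right (pow_ne_zero _ c.ne_zero)]

theorem mk_coneMap_mem_imageVariety {P : Fin (n + 1) → K} (hP : coneMap W P ≠ 0) :
    Projectivization.mk K (coneMap W P) hP ∈ imageVariety W :=
  fun _ _ hp h => (evalDual_rep_mk_eq_zero_iff hp hP).2 (h P hP)

theorem coneMap_apply (P : Fin (n + 1) → K) (F : W) : coneMap W P F = eval P F.1 := by
  simp [coneMap, aeval_eq_eval]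

theorem evalDual_coneMap (P : Fin (n + 1) → K) (p : MvPolynomial W K) :
    evalDual W (coneMap W P) p = eval P (bind₁ (fun F : W => F.1) p) := by
  have hbind := aeval_bind₁ P (fun F : W => F.1) p
  simp only [aeval_eq_eval] at hbind
  exact hbind.symm

theorem SatisfiesLaplace.exists_torus_finrank_lt [Infinite K] {s : ℕ} (h : SatisfiesLaplace W s) :
    ∃ P : Fin (n + 1) → K, (∀ i, P i ≠ 0) ∧
      Module.finrank K (osculatingSpace W s P) < (n + s).choose s := by
  obtain ⟨g, e, hg, ⟨x, hx, hgx⟩, hlt⟩ := h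
  obtain ⟨F, hF⟩ : ∃ F : W, x.rep F ≠ 0 := DFunLike.ne_iff.1 x.rep_nonzero
  have hF0 : (F : Ring n K) ≠ 0 := fun h0 => hF (by rw [Submodule.coe_eq_zero.1 h0, map_zero])
  have hg0 : bind₁ (fun F : W => F.1) g ≠ 0 := fun h0 =>
    hgx (hx g e hg fun P _ => by rw [evalDual_coneMap, h0, map_zero])
  obtain ⟨P, hP, hgFP⟩ := exists_torus_eval_ne_zero (mul_ne_zero hg0 hF0)
  rw [map_mul, ← evalDual_coneMap, ← coneMap_apply] at hgFP
  have hcone : coneMap W P ≠ 0 := fun h0 => right_ne_zero_of_mul hgFP (by simp [h0])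
  refine ⟨P, hP, hlt _ (mk_coneMap_mem_imageVariety hcone) ?_ P hcone rfl⟩
  exact (evalDual_rep_mk_eq_zero_iff hg hcone).not.2 (left_ne_zero_of_mul hgFP)

theorem coneMap_basisRestrictSupport {A : Set (Exponent n)} (P : Fin (n + 1) → K) (a : A) :
    coneMap (restrictSupport K A) P (basisRestrictSupport K A a) = ∏ i, P i ^ a.1 i := by
  rw [coneMap_apply, coe_basisRestrictSupport, eval_monomial,
    Finsupp.prod_fintype _ _ fun _ => pow_zero _, one_mul]

theorem satisfiesLaplace_of_forall_finrank_lt {A : Set (Exponent n)} (hfin : A.Finite)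
    (hne : A.Nonempty) {s : ℕ}
    (h : ∀ P : Fin (n + 1) → K, (∀ a ∈ A, ∏ i, P i ^ a i ≠ 0) →
      Module.finrank K (osculatingSpace (restrictSupport K A) s P) < (n + s).choose s) :
    SatisfiesLaplace (restrictSupport K A) s := by
  have := hfin.fintype
  let g : MvPolynomial (restrictSupport K A) K := ∏ a : A, X (basisRestrictSupport K A a)
  have hg : g.IsHomogeneous (∑ _a : A, 1) :=
    IsHomogeneous.prod _ _ _ fun a _ => isHomogeneous_X _ _
  have hgP (P : Fin (n + 1) → K) : evalDual (restrictSupport K A)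
      (coneMap (restrictSupport K A) P) g = ∏ a : A, ∏ i, P i ^ a.1 i := by
    simp only [evalDual, g, map_prod, eval_X, coneMap_basisRestrictSupport]
  have hone : coneMap (restrictSupport K A) 1 ≠ 0 := fun h0 => by
    simpa [h0] using coneMap_basisRestrictSupport (K := K) 1 ⟨_, hne.some_mem⟩
  refine ⟨g, _, hg, ⟨_, mk_coneMap_mem_imageVariety hone, ?_⟩, ?_⟩
  · rw [Ne, evalDual_rep_mk_eq_zero_iff hg, hgP]
    simp
  · rintro _ - hgx P hP rfl
    rw [Ne, evalDual_rep_mk_eq_zero_iff hg, hgP] at hgx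
    exact h P fun a ha => Finset.prod_ne_zero_iff.1 hgx ⟨a, ha⟩ (Finset.mem_univ _)

theorem finite_simplexPoints (n d : ℕ) : (simplexPoints n d).Finite :=
  Finsupp.finite_of_degree_le d |>.subset fun _ ha => le_of_eq ha

theorem satisfiesLaplace_restrictSupport_iff [Infinite K] {A : Set (Exponent n)} {d : ℕ}
    (hd : (d : K) ≠ 0) (hA : A ⊆ simplexPoints n d) (hne : A.Nonempty) (s : ℕ) :
    SatisfiesLaplace (restrictSupport K A) s ↔
      ∃ F : Ring n K, IsHypersurface s F ∧ ∀ a ∈ A, ContainsPoint F a := by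
  rw [← finrank_formValues_lt_iff, ← descFactorialSpan_eq_formValues hd fun a ha => hA ha]
  constructor
  · intro h
    obtain ⟨P, hP, hlt⟩ := h.exists_torus_finrank_lt
    rwa [finrank_osculatingSpace_of_torus A hP] at hlt
  · intro h
    refine satisfiesLaplace_of_forall_finrank_lt ((finite_simplexPoints n d).subset hA) hne ?_
    intro P hP
    rwa [finrank_osculatingSpace hP]

theorem satisfiesLaplace_inverseSystemDegree_iff [Infinite K] {d : ℕ}
    (hd : 1 ≤ d) (hdK : (d.factorial : K) ≠ 0) {G : Set (Exponent n)}
    (hG : G ⊆ simplexPoints n d) (hne : (simplexPoints n d \ G).Nonempty) (s : ℕ) :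
    SatisfiesLaplace (inverseSystemDegree (monomialIdeal K G) d) s ↔
      ∃ F : Ring n K, IsHypersurface s F ∧ ContainsLatticeSet F (monomialIdeal K G) d := by
  have hd0 : (d : K) ≠ 0 :=
    ne_zero_of_dvd_ne_zero hdK (Nat.cast_dvd_cast (Nat.dvd_factorial hd le_rfl))
  rw [inverseSystemDegree_monomialIdeal hdK hG,
    satisfiesLaplace_restrictSupport_iff hd0 Set.sdiff_subset hne]
  simp only [ContainsLatticeSet, latticeSet_monomialIdeal hdK hG]

end GeneralPoint

section Artinian

variable {n d : ℕ} {K : Type*} [Field K] {G : Set (Exponent n)}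

theorem single_mem_of_isArtinianRing (hG : G ⊆ simplexPoints n d)
    (hart : IsArtinianRing (Ring n K ⧸ monomialIdeal K G)) (i : Fin (n + 1)) :
    Finsupp.single i d ∈ G := by
  obtain ⟨k, y, hy⟩ :=
    IsArtinian.exists_pow_succ_smul_dvd (Ideal.Quotient.mk (monomialIdeal K G) (X i))
      (1 : Ring n K ⧸ monomialIdeal K G)
  obtain ⟨f, rfl⟩ := Ideal.Quotient.mk_surjective y
  have hmem : X i ^ k - X i ^ (k + 1) * f ∈ monomialIdeal K G := by
    rw [← Ideal.Quotient.eq, map_mul, map_pow, map_pow]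
    simpa using hy.symm
  have hcoeff : (X i ^ k - X i ^ (k + 1) * f).coeff (Finsupp.single i k) = 1 := by
    rw [coeff_sub, X_pow_eq_monomial, X_pow_eq_monomial, coeff_monomial, coeff_monomial_mul']
    simp
  obtain ⟨m, hm, hle⟩ := mem_monomialIdeal.1 hmem (Finsupp.single i k) (by simp [hcoeff])
  obtain ⟨l, rfl⟩ := Finsupp.support_subset_singleton'.1
    ((Finsupp.support_mono hle).trans Finsupp.support_single_subset)
  obtain rfl : l = d := by simpa [simplexPoints] using hG hm
  exact hm

theorem isArtinianRing_of_single_mem (h : ∀ i, Finsupp.single i d ∈ G) :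
    IsArtinianRing (Ring n K ⧸ monomialIdeal K G) := by
  have hX (i : Fin (n + 1)) : (Ideal.Quotient.mk (monomialIdeal K G) (X i)) ^ d = 0 := by
    rw [← map_pow, Ideal.Quotient.eq_zero_iff_mem, X_pow_eq_monomial]
    exact Ideal.subset_span ⟨_, h i, rfl⟩
  have hint : Algebra.IsIntegral K (Ring n K ⧸ monomialIdeal K G) := by
    refine ⟨fun y => ?_⟩
    obtain ⟨f, rfl⟩ := Ideal.Quotient.mk_surjective y
    induction f using MvPolynomial.induction_on with
    | C c => exact isIntegral_algebraMap (x := c)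
    | add p q hp hq => rw [map_add]; exact hp.add hq
    | mul_X p i hp =>
      rw [map_mul]
      refine hp.mul (IsIntegral.of_pow (n := d + 1) d.succ_pos ?_)
      rw [pow_succ, hX, zero_mul]
      exact isIntegral_zero
  have : Module.Finite K (Ring n K ⧸ monomialIdeal K G) := Algebra.IsIntegral.finite
  exact IsArtinianRing.of_finite K _

end Artinian

section NumberOfGenerators

variable {n d : ℕ} {G : Finset (Exponent n)}

theorem simplexPoints_diff_nonempty (hn : 1 ≤ n) (hd : 1 ≤ d)
    (hG : G.card ≤ (n + d - 1).choose (n - 1)) : (simplexPoints n d \ G).Nonempty := by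
  refine Set.sdiff_nonempty_of_ncard_lt_ncard ?_ G.finite_toSet
  rw [Set.ncard_coe_finset, ncard_simplexPoints]
  refine hG.trans_lt ?_
  obtain ⟨n, rfl⟩ := Nat.exists_eq_add_of_le' hn
  obtain ⟨d, rfl⟩ := Nat.exists_eq_add_of_le' hd
  have hpos : 0 < (n + d + 1).choose (n + 1) := Nat.choose_pos (by lia)
  calc (n + 1 + (d + 1) - 1).choose (n + 1 - 1) = (n + d + 1).choose n := by
        congr 1
        lia
    _ < (n + d + 1).choose n + (n + d + 1).choose (n + 1) := Nat.lt_add_of_pos_right hpos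
    _ = (n + 1 + (d + 1)).choose (d + 1) := by
        rw [← Nat.choose_succ_succ, ← Nat.choose_symm_add]
        congr 1
        lia

theorem two_le_of_single_mem (hn : 1 ≤ n) (hd : 1 ≤ d)
    (hG : G.card ≤ (n + d - 1).choose (n - 1)) (hv : ∀ i, Finsupp.single i d ∈ G) : 2 ≤ d := by
  by_contra! hd2
  obtain rfl : d = 1 := by lia
  have hcard : n + 1 ≤ G.card := by
    simpa using Finset.card_le_card_of_injOn (s := Finset.univ) (t := G)
      (fun i : Fin (n + 1) => Finsupp.single i 1) (fun i _ => hv i)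
      (Finsupp.single_left_injective one_ne_zero).injOn
  obtain ⟨n, rfl⟩ := Nat.exists_eq_add_of_le' hn
  rw [Nat.add_sub_cancel, Nat.add_sub_cancel, Nat.choose_succ_self_right] at hG
  lia

end NumberOfGenerators

section TogliattiSystems

variable {n d : ℕ} {K : Type*} [Field K]

theorem isMonomialTogliattiSystem_monomialIdeal_iff {G : Finset (Exponent n)}
    (hGd : (G : Set (Exponent n)) ⊆ simplexPoints n d)
    (hG : G.card ≤ (n + d - 1).choose (n - 1)) :
    IsMonomialTogliattiSystem d (monomialIdeal K (G : Set (Exponent n))) ↔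
      (∀ i, Finsupp.single i d ∈ G) ∧
        SatisfiesLaplace (inverseSystemDegree (monomialIdeal K (G : Set (Exponent n))) d)
          (d - 1) := by
  classical
  refine ⟨fun h => ⟨single_mem_of_isArtinianRing hGd h.artinian, h.laplace⟩, fun ⟨hv, hL⟩ =>
    ⟨⟨isArtinianRing_of_single_mem hv, ⟨G.image fun m => monomial m 1, ?_, ?_, ?_⟩, hL⟩, _, rfl⟩⟩
  · intro F hF
    obtain ⟨m, hm, rfl⟩ := Finset.mem_image.1 hF
    exact isHomogeneous_monomial _ (hGd hm)
  · exact Finset.card_image_le.trans hG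
  · rw [Finset.coe_image, monomialIdeal]

theorem isMinimalTogliattiSystem_monomialIdeal_iff {G : Set (Exponent n)}
    (hG : G ⊆ simplexPoints n d) :
    IsMinimalTogliattiSystem d (monomialIdeal K G) ↔
      IsMonomialTogliattiSystem d (monomialIdeal K G) ∧
        ∀ G' ⊂ G, ¬IsMonomialTogliattiSystem d (monomialIdeal K G') := by
  refine ⟨fun h => ⟨h.toIsMonomialTogliattiSystem, h.minimal G hG rfl⟩, fun ⟨hT, hmin⟩ => ⟨hT, ?_⟩⟩
  intro G₁ hG₁ hG₁G
  rwa [monomialIdeal_injOn K n d hG₁ hG hG₁G]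

theorem ContainsPoint.mul_right {F : Ring n K} {a : Exponent n} (h : ContainsPoint F a)
    (H : Ring n K) : ContainsPoint (F * H) a := by
  rw [ContainsPoint] at h ⊢
  rw [map_mul, h, zero_mul]

theorem IsHypersurface.exists_isHypersurface_mul {s t : ℕ} {F : Ring n K}
    (hF : IsHypersurface s F) (hst : s ≤ t) : ∃ H : Ring n K, IsHypersurface t (F * H) := by
  obtain ⟨k, rfl⟩ := Nat.exists_eq_add_of_le hst
  exact ⟨X 0 ^ k, mul_ne_zero hF.1 (pow_ne_zero _ (X_ne_zero 0)),
    hF.2.mul (isHomogeneous_X_pow 0 k)⟩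

theorem hypersurface_conditions_iff_top_degree (hd : 2 ≤ d) (I : Ideal (Ring n K)) :
    ((∃ s ∈ Set.Icc 1 (d - 1), ∃ F : Ring n K, IsHypersurface s F ∧ ContainsLatticeSet F I d) ∧
        ∀ s ∈ Set.Icc 1 (d - 1), ∀ F : Ring n K, IsHypersurface s F → ContainsLatticeSet F I d →
          MeetsComplementOnlyInVertices F I d) ↔
      (∃ F : Ring n K, IsHypersurface (d - 1) F ∧ ContainsLatticeSet F I d) ∧
        ∀ F : Ring n K, IsHypersurface (d - 1) F → ContainsLatticeSet F I d →
          MeetsComplementOnlyInVertices F I d := by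
  have hmem : d - 1 ∈ Set.Icc 1 (d - 1) := ⟨by lia, le_rfl⟩
  constructor
  · rintro ⟨⟨s, hs, F, hF, hFA⟩, hall⟩
    obtain ⟨H, hFH⟩ := hF.exists_isHypersurface_mul hs.2
    exact ⟨⟨F * H, hFH, fun a ha => (hFA a ha).mul_right H⟩, hall _ hmem⟩
  · rintro ⟨hex, hall⟩
    refine ⟨⟨_, hmem, hex⟩, fun s hs F hF hFA a ha hFa => ?_⟩
    obtain ⟨H, hFH⟩ := hF.exists_isHypersurface_mul hs.2
    exact hall _ hFH (fun b hb => (hFA b hb).mul_right H) a ha (hFa.mul_right H)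

variable [Infinite K] (hn : 1 ≤ n) (hd : 1 ≤ d) (hdK : (d.factorial : K) ≠ 0)
  {G : Finset (Exponent n)} (hGd : (G : Set (Exponent n)) ⊆ simplexPoints n d)
  (hG : G.card ≤ (n + d - 1).choose (n - 1))

include hn hd hdK hGd hG in
theorem isMonomialTogliattiSystem_iff_exists_isHypersurface :
    IsMonomialTogliattiSystem d (monomialIdeal K (G : Set (Exponent n))) ↔
      (∀ i, Finsupp.single i d ∈ G) ∧ ∃ F : Ring n K, IsHypersurface (d - 1) F ∧
        ∀ a ∈ simplexPoints n d \ G, ContainsPoint F a := by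
  rw [isMonomialTogliattiSystem_monomialIdeal_iff hGd hG, satisfiesLaplace_inverseSystemDegree_iff
    hd hdK hGd (simplexPoints_diff_nonempty hn hd hG)]
  simp only [ContainsLatticeSet, latticeSet_monomialIdeal hdK hGd]

include hn hd hdK hGd hG in
theorem exists_ssubset_isMonomialTogliattiSystem_iff (hv : ∀ i, Finsupp.single i d ∈ G) :
    (∃ G' ⊂ (G : Set (Exponent n)), IsMonomialTogliattiSystem d (monomialIdeal K G')) ↔
      ∃ F : Ring n K, IsHypersurface (d - 1) F ∧
        (∀ a ∈ simplexPoints n d \ G, ContainsPoint F a) ∧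
        ∃ a ∈ G, ContainsPoint F a ∧ a ∉ simplexVertices n d := by
  classical
  have iff_of_subset {G' : Finset (Exponent n)} (hsub : G' ⊆ G) :=
    isMonomialTogliattiSystem_iff_exists_isHypersurface hn hd hdK
      ((Finset.coe_subset.2 hsub).trans hGd) ((Finset.card_le_card hsub).trans hG)
  constructor
  · rintro ⟨G', hG', hT⟩
    obtain ⟨G', rfl⟩ := (G.finite_toSet.subset hG'.subset).exists_finset_coe
    obtain ⟨hv', F, hF, hFA⟩ := (iff_of_subset (Finset.coe_subset.1 hG'.subset)).1 hT
    obtain ⟨a, ha, ha'⟩ := Set.exists_of_ssubset hG'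
    refine ⟨F, hF, fun b hb => hFA b ⟨hb.1, fun h => hb.2 (hG'.subset h)⟩, a, ha,
      hFA a ⟨hGd ha, ha'⟩, ?_⟩
    rintro ⟨i, rfl⟩
    exact ha' (hv' i)
  · rintro ⟨F, hF, hFA, a, ha, hFa, hav⟩
    refine ⟨G.erase a, Finset.coe_ssubset.2 (Finset.erase_ssubset ha),
      (iff_of_subset (G.erase_subset a)).2 ⟨fun i => ?_, F, hF, fun b hb => ?_⟩⟩
    · exact Finset.mem_erase.2 ⟨fun hia => hav ⟨i, hia.symm⟩, hv i⟩
    · obtain rfl | hba := eq_or_ne b a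
      · exact hFa
      · exact hFA b ⟨hb.1, fun hbG => hb.2 (Finset.mem_coe.2 (Finset.mem_erase.2 ⟨hba, hbG⟩))⟩

include hn hd hdK hGd hG in
theorem isMinimalTogliattiSystem_iff (hv : ∀ i, Finsupp.single i d ∈ G) :
    IsMinimalTogliattiSystem d (monomialIdeal K (G : Set (Exponent n))) ↔
      (∃ F : Ring n K, IsHypersurface (d - 1) F ∧
        ContainsLatticeSet F (monomialIdeal K (G : Set (Exponent n))) d) ∧
      ∀ F : Ring n K, IsHypersurface (d - 1) F →
        ContainsLatticeSet F (monomialIdeal K (G : Set (Exponent n))) d →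
          MeetsComplementOnlyInVertices F (monomialIdeal K (G : Set (Exponent n))) d := by
  have hlat := latticeSet_monomialIdeal hdK hGd
  have hcompl : simplexPoints n d \ (simplexPoints n d \ G) = G :=
    sdiff_sdiff_eq_self hGd
  simp only [ContainsLatticeSet, MeetsComplementOnlyInVertices, hlat, hcompl, Finset.mem_coe]
  rw [isMinimalTogliattiSystem_monomialIdeal_iff hGd,
    isMonomialTogliattiSystem_iff_exists_isHypersurface hn hd hdK hGd hG]
  refine and_congr (and_iff_right hv) ?_
  have hex := (exists_ssubset_isMonomialTogliattiSystem_iff hn hd hdK hGd hG hv).not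
  push Not at hex
  exact hex

end TogliattiSystems

end Togliatti

theorem mainTheorem8_general {K : Type*} [Field K] [Infinite K] (n d : ℕ) (hn : 1 ≤ n)
    (hd : 1 ≤ d) (hdK : (d.factorial : K) ≠ 0) (G : Finset (Togliatti.Exponent n))
    (hGd : ∀ m ∈ G, m.degree = d) (hG : G.card ≤ (n + d - 1).choose (n - 1))
    (I : Ideal (Togliatti.Ring n K))
    (hI : I = Togliatti.monomialIdeal K (G : Set (Togliatti.Exponent n)))
    (hArt : IsArtinianRing (Togliatti.Ring n K ⧸ I)) :
    (∀ s ∈ Set.Icc 1 (d - 1),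
      Togliatti.SatisfiesLaplace (Togliatti.inverseSystemDegree I d) s ↔
        ∃ F : Togliatti.Ring n K,
          Togliatti.IsHypersurface s F ∧ Togliatti.ContainsLatticeSet F I d) ∧
    (∀ s : ℕ,
      IsLeast {t | t ∈ Set.Icc 1 (d - 1) ∧
          Togliatti.SatisfiesLaplace (Togliatti.inverseSystemDegree I d) t} s ↔
        IsLeast {t | t ∈ Set.Icc 1 (d - 1) ∧ ∃ F : Togliatti.Ring n K,
          Togliatti.IsHypersurface t F ∧ Togliatti.ContainsLatticeSet F I d} s) ∧
    List.TFAE [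
      Togliatti.IsMinimalTogliattiSystem d I,
      (∃ s ∈ Set.Icc 1 (d - 1), ∃ F : Togliatti.Ring n K,
          Togliatti.IsHypersurface s F ∧ Togliatti.ContainsLatticeSet F I d) ∧
        ∀ s ∈ Set.Icc 1 (d - 1), ∀ F : Togliatti.Ring n K,
          Togliatti.IsHypersurface s F → Togliatti.ContainsLatticeSet F I d →
            Togliatti.MeetsComplementOnlyInVertices F I d,
      (∃ F : Togliatti.Ring n K,
          Togliatti.IsHypersurface (d - 1) F ∧ Togliatti.ContainsLatticeSet F I d) ∧
        ∀ F : Togliatti.Ring n K,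
          Togliatti.IsHypersurface (d - 1) F → Togliatti.ContainsLatticeSet F I d →
            Togliatti.MeetsComplementOnlyInVertices F I d] := by
  open Togliatti in
  subst hI
  have hGs : (G : Set (Exponent n)) ⊆ simplexPoints n d := hGd
  have hlaplace := satisfiesLaplace_inverseSystemDegree_iff hd hdK hGs
    (simplexPoints_diff_nonempty hn hd hG)
  have hv := single_mem_of_isArtinianRing hGs hArt
  refine ⟨fun s _ => hlaplace s, fun s => by simp only [hlaplace], ?_⟩
  tfae_have 1 ↔ 3 := isMinimalTogliattiSystem_iff hn hd hdK hGs hG hv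
  tfae_have 2 ↔ 3 := hypersurface_conditions_iff_top_degree (two_le_of_single_mem hn hd hG hv) _
  tfae_finish

theorem mainTheorem8 {K : Type*} [Field K] [IsAlgClosed K] [CharZero K]
    (n d r : ℕ) (hn : 1 ≤ n) (hd : 1 ≤ d)
    (G : Finset (Togliatti.Exponent n)) (hGd : ∀ m ∈ G, m.degree = d) (hGr : G.card = r)
    (hr : r ≤ (n + d - 1).choose (n - 1))
    (I : Ideal (Togliatti.Ring n K))
    (hI : I = Togliatti.monomialIdeal K (G : Set (Togliatti.Exponent n)))
    (hArt : IsArtinianRing (Togliatti.Ring n K ⧸ I)) :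
    (∀ s ∈ Set.Icc 1 (d - 1),
      Togliatti.SatisfiesLaplace (Togliatti.inverseSystemDegree I d) s ↔
        ∃ F : Togliatti.Ring n K,
          Togliatti.IsHypersurface s F ∧ Togliatti.ContainsLatticeSet F I d) ∧
    (∀ s : ℕ,
      IsLeast {t | t ∈ Set.Icc 1 (d - 1) ∧
          Togliatti.SatisfiesLaplace (Togliatti.inverseSystemDegree I d) t} s ↔
        IsLeast {t | t ∈ Set.Icc 1 (d - 1) ∧ ∃ F : Togliatti.Ring n K,
          Togliatti.IsHypersurface t F ∧ Togliatti.ContainsLatticeSet F I d} s) ∧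
    List.TFAE [
      Togliatti.IsMinimalTogliattiSystem d I,
      (∃ s ∈ Set.Icc 1 (d - 1), ∃ F : Togliatti.Ring n K,
          Togliatti.IsHypersurface s F ∧ Togliatti.ContainsLatticeSet F I d) ∧
        ∀ s ∈ Set.Icc 1 (d - 1), ∀ F : Togliatti.Ring n K,
          Togliatti.IsHypersurface s F → Togliatti.ContainsLatticeSet F I d →
            Togliatti.MeetsComplementOnlyInVertices F I d,
      (∃ F : Togliatti.Ring n K,
          Togliatti.IsHypersurface (d - 1) F ∧ Togliatti.ContainsLatticeSet F I d) ∧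
        ∀ F : Togliatti.Ring n K,
          Togliatti.IsHypersurface (d - 1) F → Togliatti.ContainsLatticeSet F I d →
            Togliatti.MeetsComplementOnlyInVertices F I d] := by
  subst hGr
  exact mainTheorem8_general n d hn hd (Nat.cast_ne_zero.2 d.factorial_ne_zero) G hGd hr
    I hI hArt
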